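/- Let $H$ be a complex Hilbert space with a fixed orthonormal basis $(e_i)$. For bounded operators $A,B$ on $H$ let $A\circ B=U^*(A\otimes B)U$ be their Hadamard product with respect to this basis, where $A\otimes B$ acts on the Hilbert space tensor product $H\otimes H$ and $U:H\to H\otimes H$ is the isometry with $Ue_i=e_i\otimes e_i$. For self-adjoint operators, $X\le Y$ means that $Y-X$ is positive. Let $A_1,\dots,A_n$ be positive invertible bounded operators on $H$, with real powers $A_j^p$ defined by the functional calculus. Let $s,t$ be real numbers with either $1\ge t\ge s>\frac12$ or $0\le t\le s<\frac12$, and put $$r'=\min\left\{\frac{t-s}{t-1/2},\ \frac{s-1/2}{t-1/2}\right\}.$$ Then $$\begin{aligned} &\Big(\sum_{j=1}^nA_j^{1-s}\Big)\circ\Big(\sum_{j=1}^nA_j^{s}\Big)\\ &\quad+\frac{t-s}{t-1/2}\left[\Big(\sum_{j=1}^nA_j^{1-s}\Big)\circ\Big(\sum_{j=1}^nA_j^{s}\Big)-\Big(\sum_{j=1}^nA_j^{1/2}\Big)\circ\Big(\sum_{j=1}^nA_j^{1/2}\Big)\right]\\ &\quad+r'\left[\Big(\sum_{j=1}^nA_j^{1-s}\Big)\circ\Big(\sum_{j=1}^nA_j^{s}\Big)+\Big(\sum_{j=1}^nA_j^{1/2}\Big)\circ\Big(\sum_{j=1}^nA_j^{1/2}\Big)-2\Big(\sum_{j=1}^nA_j^{\frac{1+2s}{4}}\Big)\circ\Big(\sum_{j=1}^nA_j^{\frac{3-2s}{4}}\Big)\right]\\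 &\le\Big(\sum_{j=1}^nA_j^{1-t}\Big)\circ\Big(\sum_{j=1}^nA_j^{t}\Big). \end{aligned}$$ -/

import Mathlib

open scoped TensorProduct InnerProductSpace

noncomputable section

namespace HadamardOp

variable {H : Type*} [NormedAddCommGroup H] [InnerProductSpace ℂ H]
variable {ι : Type*}

variable (H) in
/-- The Hilbert space tensor product `H ⊗ H`: the completion of the algebraic tensor product with
respect to the inner product `⟪a ⊗ b, c ⊗ d⟫ = ⟪a, c⟫ * ⟪b, d⟫`. -/
abbrev HilbertTensor : Type _ := UniformSpace.Completion (H ⊗[ℂ] H)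

/-- The tensor product `A ⊗ B` of bounded operators: the continuous extension to the completion of
the bounded operator `x ⊗ y ↦ A x ⊗ B y`. -/
def opTensor (A B : H →L[ℂ] H) : HilbertTensor H →L[ℂ] HilbertTensor H :=
  (TensorProduct.mapL A B).completion

/-- The elements `e i ⊗ e i` of the Hilbert tensor product. -/
def diagVec (e : HilbertBasis ι ℂ H) (i : ι) : HilbertTensor H :=
  ((e i ⊗ₜ[ℂ] e i : H ⊗[ℂ] H) : HilbertTensor H)

theorem orthonormal_diagVec (e : HilbertBasis ι ℂ H) : Orthonormal ℂ (diagVec e) := by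
  classical
  rw [orthonormal_iff_ite]
  intro i j
  have h := orthonormal_iff_ite.mp e.orthonormal i j
  simp only [diagVec, UniformSpace.Completion.inner_coe, TensorProduct.inner_tmul, h]
  split_ifs <;> simp

/-- The isometry `U : H → H ⊗ H` determined by `U (e i) = e i ⊗ e i`, that is,
`x = ∑ x_i e_i ↦ ∑ x_i (e_i ⊗ e_i)`. -/
def diagIsometry (e : HilbertBasis ι ℂ H) : H →ₗᵢ[ℂ] HilbertTensor H :=
  (orthonormal_diagVec e).orthogonalFamily.linearIsometry.comp e.repr.toLinearIsometry

/-- The Hadamard product `A ∘ B = U* (A ⊗ B) U` of bounded operators with respect to the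
orthonormal basis `e`. -/
def hadamard [CompleteSpace H] (e : HilbertBasis ι ℂ H) (A B : H →L[ℂ] H) : H →L[ℂ] H :=
  ContinuousLinearMap.adjoint (diagIsometry e).toContinuousLinearMap ∘L opTensor A B ∘L
    (diagIsometry e).toContinuousLinearMap

end HadamardOp

end

/-! The Hadamard product is commutative, so twice each product of sums is a double sum over pairs
`(A i, A j)` of compressed Heinz sums `a^(1-p) b^p + a^p b^(1-p)`, where `a = A i ⊗ 1` and `b = 1 ⊗
A j` commute. With `z = log b - log a` and `N = exp ((log a + log b) / 4)`, such a sum equals `N *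
2cosh((p - 1/2) z) * N` (`exp_heinz_eq`). Functional calculus, conjugation by `N`, compression along
`U` and summation over pairs all preserve positivity and linear combinations. The theorem thus
reduces to a scalar inequality between values of cosh (`Real.refined_cosh_le`), which rests on `cosh
(μ x) - 1 ≤ μ² (cosh x - 1)` for `0 ≤ μ ≤ 1`. -/

/-! ### Scalar inequalities for hyperbolic functions -/

theorem Real.convexOn_sinh : ConvexOn ℝ (Set.Ici 0) Real.sinh := by
  apply convexOn_of_deriv2_nonneg (convex_Ici 0) Real.continuous_sinh.continuousOn
    Real.differentiable_sinh.differentiableOn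
  · simpa using Real.differentiable_cosh.differentiableOn
  · intro x hx
    simp only [Function.iterate_succ, Function.iterate_zero, Function.comp_apply, id,
      Real.deriv_sinh, Real.deriv_cosh]
    exact Real.sinh_nonneg_iff.mpr (interior_subset hx)

theorem Real.sinh_mul_le {μ x : ℝ} (hμ0 : 0 ≤ μ) (hμ1 : μ ≤ 1) (hx : 0 ≤ x) :
    Real.sinh (μ * x) ≤ μ * Real.sinh x := by
  have h := Real.convexOn_sinh.2 (Set.mem_Ici.2 hx) (Set.mem_Ici.2 le_rfl) hμ0
    (sub_nonneg.2 hμ1) (by ring)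
  simpa using h

theorem Real.cosh_sub_one (x : ℝ) : Real.cosh x - 1 = 2 * Real.sinh (x / 2) ^ 2 := by
  have h := Real.cosh_two_mul (x / 2)
  rw [Real.cosh_sq', mul_div_cancel₀ x two_ne_zero] at h
  linarith

/-- The half-angle formula turns both sides into squares of sinh, where convexity and `sinh 0 = 0`
apply; evenness of cosh removes the sign of `x`. -/
theorem Real.cosh_mul_sub_one_le {μ x : ℝ} (hμ0 : 0 ≤ μ) (hμ1 : μ ≤ 1) :
    Real.cosh (μ * x) - 1 ≤ μ ^ 2 * (Real.cosh x - 1) := by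
  have key : ∀ y : ℝ, 0 ≤ y → Real.cosh (μ * y) - 1 ≤ μ ^ 2 * (Real.cosh y - 1) := by
    intro y hy
    rw [Real.cosh_sub_one, Real.cosh_sub_one, mul_div_assoc]
    have h := Real.sinh_mul_le hμ0 hμ1 (x := y / 2) (by positivity)
    have h0 : 0 ≤ Real.sinh (μ * (y / 2)) := Real.sinh_nonneg_iff.2 (by positivity)
    have := pow_le_pow_left₀ h0 h 2
    rw [mul_pow] at this
    linarith
  have h := key |x| (abs_nonneg x)
  rwa [Real.cosh_abs, ← Real.cosh_abs (μ * |x|), abs_mul, abs_abs, ← abs_mul,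
    Real.cosh_abs] at h

/-- Write `a`, `b`, `c` for the values of cosh at `s`, `t` and the intermediate exponent, and `l`
for the quotient. Since `c ≥ 1` and `r ≤ l`, the `r`-term is at most `l (a - 1)`, so `(1 + 2l)(a -
1) ≤ b - 1` suffices. The trivial factor `1/2 - 1/2` keeps the shape of the operator statements at
`p = 1/2`. -/
theorem Real.refined_cosh_le {s t r : ℝ}
    (hst : (1 / 2 < s ∧ s ≤ t) ∨ (s < 1 / 2 ∧ t ≤ s)) (hr0 : 0 ≤ r)
    (hr : r ≤ (t - s) / (t - 1 / 2)) (x : ℝ) :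
    0 ≤ Real.cosh ((t - 1 / 2) * x)
      - (Real.cosh ((s - 1 / 2) * x)
        + (t - s) / (t - 1 / 2) *
          (Real.cosh ((s - 1 / 2) * x) - Real.cosh ((1 / 2 - 1 / 2) * x))
        + r * (Real.cosh ((s - 1 / 2) * x) + Real.cosh ((1 / 2 - 1 / 2) * x)
          - 2 * Real.cosh (((3 - 2 * s) / 4 - 1 / 2) * x))) := by
  have ht : t - 1 / 2 ≠ 0 := by
    rcases hst with h | h
    · exact (by linarith : 0 < t - 1 / 2).ne'
    · exact (by linarith : t - 1 / 2 < 0).ne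
  set l := (t - s) / (t - 1 / 2) with hl
  have hs : s - 1 / 2 = (1 - l) * (t - 1 / 2) := by rw [hl, sub_mul, div_mul_cancel₀ _ ht]; ring
  have hl1 : l ≤ 1 := by
    rw [hl]
    rcases hst with h | h
    · rw [div_le_one (by linarith)]; linarith
    · rw [div_le_one_of_neg (by linarith)]; linarith
  have hl0 : 0 ≤ l := hr0.trans hr
  have h1 := Real.cosh_mul_sub_one_le (x := (t - 1 / 2) * x) (sub_nonneg.2 hl1) (by linarith)
  rw [← mul_assoc, ← hs] at h1
  have h2 := Real.one_le_cosh (((3 - 2 * s) / 4 - 1 / 2) * x)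
  have h3 := Real.one_le_cosh ((s - 1 / 2) * x)
  have h4 := Real.one_le_cosh ((t - 1 / 2) * x)
  simp only [sub_self, zero_mul, Real.cosh_zero]
  generalize Real.cosh ((s - 1 / 2) * x) = a at *
  generalize Real.cosh ((t - 1 / 2) * x) = b at *
  generalize Real.cosh (((3 - 2 * s) / 4 - 1 / 2) * x) = c at *
  -- Here `μ = 1 - l`, and `(1 + 2l)(1 - l)² = 1 - l²(3 - 2l) ≤ 1`.
  have h5 : (1 + 2 * l) * (a - 1) ≤ b - 1 := by
    calc (1 + 2 * l) * (a - 1) ≤ (1 + 2 * l) * ((1 - l) ^ 2 * (b - 1)) := by gcongr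
      _ = (1 - l ^ 2 * (3 - 2 * l)) * (b - 1) := by ring
      _ ≤ 1 * (b - 1) := by
        refine mul_le_mul_of_nonneg_right ?_ (sub_nonneg.2 h4)
        have : 0 ≤ l ^ 2 * (3 - 2 * l) := mul_nonneg (sq_nonneg l) (by linarith)
        linarith
      _ = b - 1 := one_mul _
  have h6 := mul_nonneg (sub_nonneg.2 hr) (sub_nonneg.2 h3)
  have h7 := mul_nonneg hr0 (sub_nonneg.2 h2)
  linarith

/-! ### Heinz sums of commuting elements in a C⋆-algebra -/

section CStar
variable {𝔄 : Type*} [CStarAlgebra 𝔄]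

theorem CFC.rpow_eq_exp_smul_log [PartialOrder 𝔄] [StarOrderedRing 𝔄] {a : 𝔄} (ha : 0 ≤ a)
    (hu : IsUnit a) (p : ℝ) : a ^ p = NormedSpace.exp (p • CFC.log a) := by
  have hpos : ∀ x ∈ spectrum ℝ a, 0 < x := fun x hx =>
    lt_of_le_of_ne (spectrum_nonneg_of_nonneg ha hx)
      fun h => spectrum.zero_notMem ℝ hu (h ▸ hx)
  have hlog : ContinuousOn Real.log (spectrum ℝ a) :=
    Real.continuousOn_log.mono fun x hx => (hpos x hx).ne'
  have hsa : IsSelfAdjoint (p • CFC.log a) := (IsSelfAdjoint.all p).smul IsSelfAdjoint.log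
  rw [CFC.rpow_eq_cfc_real, ← CFC.real_exp_eq_normedSpace_exp hsa, CFC.log,
    ← cfc_smul p Real.log a, ← cfc_comp' Real.exp _ a]
  refine cfc_congr fun x hx => ?_
  simp only [smul_eq_mul]
  rw [Real.rpow_def_of_pos (hpos x hx), mul_comm]

theorem CFC.exp_smul_add_exp_neg_smul {z : 𝔄} (hz : IsSelfAdjoint z) (u : ℝ) :
    NormedSpace.exp (u • z) + NormedSpace.exp (-u • z) =
      cfc (fun x : ℝ => 2 * Real.cosh (u * x)) z := by
  have h (v : ℝ) : NormedSpace.exp (v • z) = cfc (fun x : ℝ => Real.exp (v * x)) z := by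
    rw [← CFC.real_exp_eq_normedSpace_exp ((IsSelfAdjoint.all v).smul hz)]
    rw [← cfc_comp_smul v Real.exp z]
    rfl
  rw [h, h, ← cfc_add z _ _ (by fun_prop) (by fun_prop)]
  refine cfc_congr fun x _ => ?_
  simp only [Real.cosh_eq, neg_mul]
  ring

open NormedSpace in
-- The two exponents are `(a + b)/2 ± (p - 1/2)(b - a)`. Splitting `exp ((a + b)/2)` into two equal
-- outer factors makes the right side a self-adjoint conjugation.
theorem exp_heinz_eq {a b : 𝔄} (ha : IsSelfAdjoint a) (hb : IsSelfAdjoint b) (hab : Commute a b)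
    (p : ℝ) :
    exp ((1 - p) • a + p • b) + exp (p • a + (1 - p) • b) =
      exp ((1 / 4 : ℝ) • (a + b)) * cfc (fun x : ℝ => 2 * Real.cosh ((p - 1 / 2) * x)) (b - a) *
        exp ((1 / 4 : ℝ) • (a + b)) := by
  let +nondep : NormedAlgebra ℚ 𝔄 := .restrictScalars ℚ ℝ 𝔄
  have hc : Commute (a + b) (b - a) :=
    ((hab.add_left (Commute.refl b)).sub_right ((Commute.refl a).add_left hab.symm))
  have h (u : ℝ) : exp ((1 / 2 : ℝ) • (a + b) + u • (b - a)) =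
      exp ((1 / 4 : ℝ) • (a + b)) * exp (u • (b - a)) * exp ((1 / 4 : ℝ) • (a + b)) := by
    rw [← exp_add_of_commute ((hc.smul_left _).smul_right _), ← exp_add_of_commute]
    · congr 1
      module
    · exact (((Commute.refl _).smul_left _).smul_right _).add_left
        ((hc.symm.smul_left _).smul_right _)
  rw [← CFC.exp_smul_add_exp_neg_smul (hb.sub ha), mul_add, add_mul, ← h, ← h]
  congr 2 <;> module

open NormedSpace in
theorem exp_heinz_refined_le [PartialOrder 𝔄] [StarOrderedRing 𝔄] {a b : 𝔄}
    (ha : IsSelfAdjoint a) (hb : IsSelfAdjoint b) (hab : Commute a b) {s t r : ℝ}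
    (hst : (1 / 2 < s ∧ s ≤ t) ∨ (s < 1 / 2 ∧ t ≤ s)) (hr0 : 0 ≤ r)
    (hr : r ≤ (t - s) / (t - 1 / 2)) {w : ℝ → 𝔄}
    (hw : ∀ p, w p = exp ((1 - p) • a + p • b) + exp (p • a + (1 - p) • b)) :
    0 ≤ w t - (w s + ((t - s) / (t - 1 / 2)) • (w s - w (1 / 2))
      + r • (w s + w (1 / 2) - (2 : ℝ) • w ((3 - 2 * s) / 4))) := by
  set N := exp ((1 / 4 : ℝ) • (a + b))
  have hNsa : IsSelfAdjoint N := ((IsSelfAdjoint.all _).smul (ha.add hb)).exp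
  have hz := hb.sub ha
  -- Working in `C(spectrum, ℝ)` lets linearity of `cfcHom` carry the whole combination at once.
  let g (p : ℝ) : C(spectrum ℝ (b - a), ℝ) :=
    ⟨fun x => 2 * Real.cosh ((p - 1 / 2) * x), by fun_prop⟩
  have hwc (p : ℝ) : w p = N * cfcHom hz (g p) * N := by
    rw [hw, exp_heinz_eq ha hb hab, cfc_apply _ _ hz (by fun_prop)]
    rfl
  have hnn : 0 ≤ cfcHom hz (g t - (g s + ((t - s) / (t - 1 / 2)) • (g s - g (1 / 2))
      + r • (g s + g (1 / 2) - (2 : ℝ) • g ((3 - 2 * s) / 4)))) := by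
    rw [cfcHom_nonneg_iff, ContinuousMap.le_def]
    intro x
    have := Real.refined_cosh_le hst hr0 hr (x : ℝ)
    simp only [g, ContinuousMap.sub_apply, ContinuousMap.add_apply, ContinuousMap.smul_apply,
      ContinuousMap.coe_mk, ContinuousMap.zero_apply, smul_eq_mul]
    linarith
  have := hNsa.conjugate_nonneg hnn
  simp only [hwc]
  convert this using 1
  simp only [map_sub, map_add, map_smul, mul_sub, sub_mul, mul_add, add_mul, mul_smul_comm,
    smul_mul_assoc]

open NormedSpace in
-- Star homomorphisms are contractive, hence commute with exp, and powers of positive invertible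
-- elements are exponentials of multiples of the logarithm.
theorem StarAlgHom.map_rpow_mul_map_rpow {𝔅 : Type*} [CStarAlgebra 𝔅] [PartialOrder 𝔄]
    [StarOrderedRing 𝔄] (f g : 𝔄 →⋆ₐ[ℂ] 𝔅) (hfg : ∀ a b, Commute (f a) (g b)) {a b : 𝔄}
    (ha : 0 ≤ a) (hau : IsUnit a) (hb : 0 ≤ b) (hbu : IsUnit b) (p q : ℝ) :
    f (a ^ p) * g (b ^ q) = exp (p • f (CFC.log a) + q • g (CFC.log b)) := by
  let +nondep : NormedAlgebra ℚ 𝔄 := .restrictScalars ℚ ℝ 𝔄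
  let +nondep : NormedAlgebra ℚ 𝔅 := .restrictScalars ℚ ℝ 𝔅
  have hf : Continuous f := AddMonoidHomClass.continuous_of_bound f 1 fun x => by
    simpa using NonUnitalStarAlgHom.norm_apply_le f x
  have hg : Continuous g := AddMonoidHomClass.continuous_of_bound g 1 fun x => by
    simpa using NonUnitalStarAlgHom.norm_apply_le g x
  rw [exp_add_of_commute (((hfg _ _).smul_left p).smul_right q), CFC.rpow_eq_exp_smul_log ha hau,
    CFC.rpow_eq_exp_smul_log hb hbu, map_exp f hf, map_exp g hg]
  congr 2
  · exact map_smul f (p : ℂ) (CFC.log a)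
  · exact map_smul g (q : ℂ) (CFC.log b)

theorem StarAlgHom.heinz_refined_le {𝔅 : Type*} [CStarAlgebra 𝔅] [PartialOrder 𝔄]
    [StarOrderedRing 𝔄] [PartialOrder 𝔅] [StarOrderedRing 𝔅] (f g : 𝔄 →⋆ₐ[ℂ] 𝔅)
    (hfg : ∀ a b, Commute (f a) (g b)) {a b : 𝔄}
    (ha : 0 ≤ a) (hau : IsUnit a) (hb : 0 ≤ b) (hbu : IsUnit b) {s t r : ℝ}
    (hst : (1 / 2 < s ∧ s ≤ t) ∨ (s < 1 / 2 ∧ t ≤ s)) (hr0 : 0 ≤ r)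
    (hr : r ≤ (t - s) / (t - 1 / 2)) {w : ℝ → 𝔅}
    (hw : ∀ p, w p = f (a ^ (1 - p)) * g (b ^ p) + f (a ^ p) * g (b ^ (1 - p))) :
    0 ≤ w t - (w s + ((t - s) / (t - 1 / 2)) • (w s - w (1 / 2))
      + r • (w s + w (1 / 2) - (2 : ℝ) • w ((3 - 2 * s) / 4))) := by
  refine exp_heinz_refined_le (IsSelfAdjoint.log.map f) (IsSelfAdjoint.log.map g)
    (hfg (CFC.log a) (CFC.log b)) hst hr0 hr fun p => ?_
  rw [hw, map_rpow_mul_map_rpow f g hfg ha hau hb hbu, map_rpow_mul_map_rpow f g hfg ha hau hb hbu]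
end CStar

/-! ### Tensor products of operators and the Hadamard product -/

noncomputable section
namespace HadamardOp

variable {H : Type*} [NormedAddCommGroup H] [InnerProductSpace ℂ H] {ι : Type*}

theorem opTensor_coe_tmul (A B : H →L[ℂ] H) (x y : H) :
    opTensor A B ((x ⊗ₜ[ℂ] y : H ⊗[ℂ] H) : HilbertTensor H) =
      ((A x ⊗ₜ[ℂ] B y : H ⊗[ℂ] H) : HilbertTensor H) := by
  simp [opTensor]

theorem ext_coe_tmul {T S : HilbertTensor H →L[ℂ] HilbertTensor H}
    (h : ∀ x y : H, T ((x ⊗ₜ[ℂ] y : H ⊗[ℂ] H) : HilbertTensor H) =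
      S ((x ⊗ₜ[ℂ] y : H ⊗[ℂ] H) : HilbertTensor H)) : T = S := by
  ext v
  induction v using UniformSpace.Completion.induction_on with
  | hp => exact isClosed_eq T.continuous S.continuous
  | ih v =>
    induction v using TensorProduct.induction_on with
    | zero => rw [UniformSpace.Completion.coe_zero, map_zero, map_zero]
    | tmul x y => exact h x y
    | add v w hv hw => rw [UniformSpace.Completion.coe_add, map_add, map_add, hv, hw]

theorem opTensor_add_left (A A' B : H →L[ℂ] H) :
    opTensor (A + A') B = opTensor A B + opTensor A' B :=
  ext_coe_tmul fun x y => by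
    simp [opTensor_coe_tmul, TensorProduct.add_tmul, UniformSpace.Completion.coe_add]

theorem opTensor_add_right (A B B' : H →L[ℂ] H) :
    opTensor A (B + B') = opTensor A B + opTensor A B' :=
  ext_coe_tmul fun x y => by
    simp [opTensor_coe_tmul, TensorProduct.tmul_add, UniformSpace.Completion.coe_add]

theorem opTensor_smul_left (c : ℂ) (A B : H →L[ℂ] H) :
    opTensor (c • A) B = c • opTensor A B :=
  ext_coe_tmul fun x y => by
    rw [smul_apply, opTensor_coe_tmul, opTensor_coe_tmul,
      smul_apply, ← TensorProduct.smul_tmul', UniformSpace.Completion.coe_smul]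

theorem opTensor_smul_right (c : ℂ) (A B : H →L[ℂ] H) :
    opTensor A (c • B) = c • opTensor A B :=
  ext_coe_tmul fun x y => by
    rw [smul_apply, opTensor_coe_tmul, opTensor_coe_tmul,
      smul_apply, TensorProduct.tmul_smul, UniformSpace.Completion.coe_smul]

theorem opTensor_mul (A A' B B' : H →L[ℂ] H) :
    opTensor (A * A') (B * B') = opTensor A B * opTensor A' B' :=
  ext_coe_tmul fun x y => by simp [opTensor_coe_tmul]

theorem opTensor_one : opTensor (1 : H →L[ℂ] H) 1 = 1 :=
  ext_coe_tmul fun x y => by simp [opTensor_coe_tmul]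

theorem opTensor_eq_mul (A B : H →L[ℂ] H) : opTensor A B = opTensor A 1 * opTensor 1 B := by
  rw [← opTensor_mul, mul_one, one_mul]

theorem commute_opTensor_one_one_opTensor (A B : H →L[ℂ] H) :
    Commute (opTensor A 1) (opTensor 1 B) := by
  rw [Commute, SemiconjBy, ← opTensor_mul, ← opTensor_mul, mul_one, one_mul, mul_one, one_mul]

theorem diagIsometry_apply_basis (e : HilbertBasis ι ℂ H) (i : ι) :
    diagIsometry e (e i) = diagVec e i := by
  classical
  have h : diagIsometry e (e i) = (orthonormal_diagVec e).orthogonalFamily.linearIsometry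
      (e.repr (e i)) := rfl
  rw [h, e.repr_self, OrthogonalFamily.linearIsometry_apply_single]
  simp

variable [CompleteSpace H]

theorem adjoint_opTensor (A B : H →L[ℂ] H) :
    ContinuousLinearMap.adjoint (opTensor A B) =
      opTensor (ContinuousLinearMap.adjoint A) (ContinuousLinearMap.adjoint B) := by
  symm
  rw [ContinuousLinearMap.eq_adjoint_iff]
  intro v w
  induction v, w using UniformSpace.Completion.induction_on₂ with
  | hp => exact isClosed_eq (by fun_prop) (by fun_prop)
  | ih v w =>
    induction v using TensorProduct.induction_on with
    | zero => rw [UniformSpace.Completion.coe_zero, map_zero, inner_zero_left, inner_zero_left]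
    | add v v' hv hv' =>
      rw [UniformSpace.Completion.coe_add, map_add, inner_add_left, inner_add_left, hv, hv']
    | tmul x y =>
      induction w using TensorProduct.induction_on with
      | zero => rw [UniformSpace.Completion.coe_zero, map_zero, inner_zero_right, inner_zero_right]
      | add w w' hw hw' =>
        rw [UniformSpace.Completion.coe_add, map_add, inner_add_right, inner_add_right, hw, hw']
      | tmul x' y' =>
        simp [opTensor_coe_tmul, ContinuousLinearMap.adjoint_inner_left]

variable (H) in
/-- The homomorphism `A ↦ A ⊗ 1`. -/
def leftTensorHom : (H →L[ℂ] H) →⋆ₐ[ℂ] (HilbertTensor H →L[ℂ] HilbertTensor H) where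
  toFun A := opTensor A 1
  map_one' := opTensor_one
  map_mul' A B := by rw [← opTensor_mul, one_mul]
  map_zero' := by simpa using opTensor_smul_left 0 (0 : H →L[ℂ] H) 1
  map_add' A B := opTensor_add_left A B 1
  commutes' c := by
    rw [Algebra.algebraMap_eq_smul_one, Algebra.algebraMap_eq_smul_one, opTensor_smul_left,
      opTensor_one]
  map_star' A := by
    have h := adjoint_opTensor A 1
    rw [← ContinuousLinearMap.star_eq_adjoint 1, star_one] at h
    exact h.symm

variable (H) in
/-- The homomorphism `B ↦ 1 ⊗ B`. -/
def rightTensorHom : (H →L[ℂ] H) →⋆ₐ[ℂ] (HilbertTensor H →L[ℂ] HilbertTensor H) where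
  toFun B := opTensor 1 B
  map_one' := opTensor_one
  map_mul' A B := by rw [← opTensor_mul, one_mul]
  map_zero' := by simpa using opTensor_smul_right 0 (1 : H →L[ℂ] H) 0
  map_add' A B := opTensor_add_right 1 A B
  commutes' c := by
    rw [Algebra.algebraMap_eq_smul_one, Algebra.algebraMap_eq_smul_one, opTensor_smul_right,
      opTensor_one]
  map_star' A := by
    have h := adjoint_opTensor 1 A
    rw [← ContinuousLinearMap.star_eq_adjoint 1, star_one] at h
    exact h.symm

section Compression
variable {K : Type*} [NormedAddCommGroup K] [InnerProductSpace ℂ K] [CompleteSpace K]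

/-- Compression of operators along `V`, that is, `T ↦ V* T V`. -/
def compress (V : H →L[ℂ] K) : (K →L[ℂ] K) →ₗ[ℝ] (H →L[ℂ] H) where
  toFun T := ContinuousLinearMap.adjoint V ∘L T ∘L V
  map_add' S T := by ext; simp
  map_smul' c T := by ext x; simp

theorem compress_nonneg (V : H →L[ℂ] K) {T : K →L[ℂ] K} (hT : 0 ≤ T) : 0 ≤ compress V T := by
  rw [ContinuousLinearMap.nonneg_iff_isPositive] at hT ⊢
  exact hT.adjoint_conj _

theorem compress_heinz_refined_le (V : H →L[ℂ] K) (f g : (H →L[ℂ] H) →⋆ₐ[ℂ] (K →L[ℂ] K))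
    (hfg : ∀ A B, Commute (f A) (g B)) {A B : H →L[ℂ] H} (hA : 0 ≤ A) (hAu : IsUnit A)
    (hB : 0 ≤ B) (hBu : IsUnit B) {s t r : ℝ}
    (hst : (1 / 2 < s ∧ s ≤ t) ∨ (s < 1 / 2 ∧ t ≤ s)) (hr0 : 0 ≤ r)
    (hr : r ≤ (t - s) / (t - 1 / 2)) {w : ℝ → H →L[ℂ] H}
    (hw : ∀ p, w p = compress V (f (A ^ (1 - p)) * g (B ^ p) + f (A ^ p) * g (B ^ (1 - p)))) :
    0 ≤ w t - (w s + ((t - s) / (t - 1 / 2)) • (w s - w (1 / 2))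
      + r • (w s + w (1 / 2) - (2 : ℝ) • w ((3 - 2 * s) / 4))) := by
  have h := compress_nonneg V
    (StarAlgHom.heinz_refined_le f g hfg hA hAu hB hBu hst hr0 hr fun _ => rfl)
  simpa only [map_sub, map_add (compress V) (_ - _), map_add (compress V) (_ + _), map_smul, ← hw]
    using h
end Compression

theorem hadamard_eq_compress (e : HilbertBasis ι ℂ H) (A B : H →L[ℂ] H) :
    hadamard e A B = compress (diagIsometry e).toContinuousLinearMap (opTensor A B) := rfl

theorem inner_hadamard_basis (e : HilbertBasis ι ℂ H) (A B : H →L[ℂ] H) (i j : ι) :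
    ⟪e i, hadamard e A B (e j)⟫_ℂ = ⟪e i, A (e j)⟫_ℂ * ⟪e i, B (e j)⟫_ℂ := by
  simp [hadamard, ContinuousLinearMap.adjoint_inner_right, diagIsometry_apply_basis, diagVec,
    opTensor_coe_tmul]

/-- Matrix entries in the basis `e` multiply pointwise. This symmetry is what produces Heinz sums
from one-sided products. -/
theorem hadamard_comm (e : HilbertBasis ι ℂ H) (A B : H →L[ℂ] H) :
    hadamard e A B = hadamard e B A := by
  refine ContinuousLinearMap.ext_on (s := Set.range e)
    (by rw [Submodule.dense_iff_topologicalClosure_eq_top]; exact e.dense_span) ?_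
  rintro _ ⟨j, rfl⟩
  refine e.repr.injective (lp.ext (funext fun i => ?_))
  rw [e.repr_apply_apply, e.repr_apply_apply, inner_hadamard_basis, inner_hadamard_basis, mul_comm]

theorem hadamard_heinz_refined_le (e : HilbertBasis ι ℂ H) {A B : H →L[ℂ] H} (hA : 0 ≤ A)
    (hAu : IsUnit A) (hB : 0 ≤ B) (hBu : IsUnit B) {s t r : ℝ}
    (hst : (1 / 2 < s ∧ s ≤ t) ∨ (s < 1 / 2 ∧ t ≤ s)) (hr0 : 0 ≤ r)
    (hr : r ≤ (t - s) / (t - 1 / 2)) {w : ℝ → H →L[ℂ] H}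
    (hw : ∀ p, w p = hadamard e (A ^ (1 - p)) (B ^ p) + hadamard e (A ^ p) (B ^ (1 - p))) :
    0 ≤ w t - (w s + ((t - s) / (t - 1 / 2)) • (w s - w (1 / 2))
      + r • (w s + w (1 / 2) - (2 : ℝ) • w ((3 - 2 * s) / 4))) := by
  refine compress_heinz_refined_le (diagIsometry e).toContinuousLinearMap (leftTensorHom H)
    (rightTensorHom H) commute_opTensor_one_one_opTensor hA hAu hB hBu hst hr0 hr fun p => ?_
  rw [hw, map_add, hadamard_eq_compress, hadamard_eq_compress, opTensor_eq_mul,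
    opTensor_eq_mul (A ^ p)]
  rfl

theorem hadamard_add_left (e : HilbertBasis ι ℂ H) (A A' B : H →L[ℂ] H) :
    hadamard e (A + A') B = hadamard e A B + hadamard e A' B := by
  simp [hadamard, opTensor_add_left, ContinuousLinearMap.comp_add, ContinuousLinearMap.add_comp]

theorem hadamard_sum_left {κ : Type*} (e : HilbertBasis ι ℂ H) (S : Finset κ)
    (A : κ → (H →L[ℂ] H)) (B : H →L[ℂ] H) :
    hadamard e (∑ j ∈ S, A j) B = ∑ j ∈ S, hadamard e (A j) B :=
  map_sum (AddMonoidHom.mk' (hadamard e · B) (hadamard_add_left e · · B)) A S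

theorem hadamard_sum_sum {κ : Type*} [Fintype κ] (e : HilbertBasis ι ℂ H)
    (A B : κ → (H →L[ℂ] H)) :
    hadamard e (∑ j, A j) (∑ j, B j) = ∑ i, ∑ j, hadamard e (A i) (B j) := by
  rw [hadamard_sum_left]
  refine Finset.sum_congr rfl fun i _ => ?_
  rw [hadamard_comm, hadamard_sum_left]
  exact Finset.sum_congr rfl fun j _ => hadamard_comm e _ _

theorem two_smul_hadamard_sum_rpow {κ : Type*} [Fintype κ] (e : HilbertBasis ι ℂ H)
    (A : κ → (H →L[ℂ] H)) (p : ℝ) :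
    (2 : ℝ) • hadamard e (∑ j, A j ^ (1 - p)) (∑ j, A j ^ p) =
      ∑ i, ∑ j, (hadamard e (A i ^ (1 - p)) (A j ^ p) + hadamard e (A i ^ p) (A j ^ (1 - p))) := by
  simp only [Finset.sum_add_distrib, ← hadamard_sum_sum]
  rw [two_smul, hadamard_comm e (∑ j, A j ^ p)]

theorem hadamard_sum_rpow_refined_le {κ : Type*} [Fintype κ] (e : HilbertBasis ι ℂ H)
    {A : κ → (H →L[ℂ] H)} (hA : ∀ j, 0 ≤ A j ∧ IsUnit (A j)) {s t r : ℝ}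
    (hst : (1 / 2 < s ∧ s ≤ t) ∨ (s < 1 / 2 ∧ t ≤ s)) (hr0 : 0 ≤ r)
    (hr : r ≤ (t - s) / (t - 1 / 2)) {w : ℝ → H →L[ℂ] H}
    (hw : ∀ p, w p = hadamard e (∑ j, A j ^ (1 - p)) (∑ j, A j ^ p)) :
    w s + ((t - s) / (t - 1 / 2)) • (w s - w (1 / 2))
      + r • (w s + w (1 / 2) - (2 : ℝ) • w ((3 - 2 * s) / 4)) ≤ w t := by
  set v : κ → κ → ℝ → H →L[ℂ] H := fun i j p =>
    hadamard e (A i ^ (1 - p)) (A j ^ p) + hadamard e (A i ^ p) (A j ^ (1 - p))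
  have hwv (p : ℝ) : w p = (1 / 2 : ℝ) • ∑ i, ∑ j, v i j p := by
    rw [← two_smul_hadamard_sum_rpow, ← hw, smul_smul]
    norm_num
  have h := Finset.sum_nonneg fun i (_ : i ∈ Finset.univ) => Finset.sum_nonneg fun j
    (_ : j ∈ Finset.univ) => hadamard_heinz_refined_le (w := v i j) e (hA i).1 (hA i).2
      (hA j).1 (hA j).2 hst hr0 hr fun _ => rfl
  simp only [Finset.sum_sub_distrib, Finset.sum_add_distrib, ← Finset.smul_sum] at h
  rw [← sub_nonneg]
  simp only [hwv]
  convert smul_nonneg (by norm_num : (0 : ℝ) ≤ 1 / 2) h using 1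
  module

end HadamardOp
end

theorem corollary2p9 {H : Type*} [NormedAddCommGroup H] [InnerProductSpace ℂ H] [CompleteSpace H]
    {ι : Type*} (e : HilbertBasis ι ℂ H) (n : ℕ) (A : Fin n → (H →L[ℂ] H))
    (hA : ∀ j, 0 ≤ A j ∧ IsUnit (A j)) (s t r' : ℝ)
    (hst : (1 ≥ t ∧ t ≥ s ∧ s > 1 / 2) ∨ (0 ≤ t ∧ t ≤ s ∧ s < 1 / 2))
    (hr' : r' = min ((t - s) / (t - 1 / 2)) ((s - 1 / 2) / (t - 1 / 2))) :
    HadamardOp.hadamard e (∑ j, A j ^ (1 - s)) (∑ j, A j ^ s)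
      + ((t - s) / (t - 1 / 2)) •
        (HadamardOp.hadamard e (∑ j, A j ^ (1 - s)) (∑ j, A j ^ s)
          - HadamardOp.hadamard e (∑ j, A j ^ (1 / 2 : ℝ)) (∑ j, A j ^ (1 / 2 : ℝ)))
      + r' •
        (HadamardOp.hadamard e (∑ j, A j ^ (1 - s)) (∑ j, A j ^ s)
          + HadamardOp.hadamard e (∑ j, A j ^ (1 / 2 : ℝ)) (∑ j, A j ^ (1 / 2 : ℝ))
          - (2 : ℝ) • HadamardOp.hadamard e (∑ j, A j ^ ((1 + 2 * s) / 4))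
              (∑ j, A j ^ ((3 - 2 * s) / 4)))
    ≤ HadamardOp.hadamard e (∑ j, A j ^ (1 - t)) (∑ j, A j ^ t) := by
  have hst' : (1 / 2 < s ∧ s ≤ t) ∨ (s < 1 / 2 ∧ t ≤ s) :=
    hst.imp (fun h => ⟨h.2.2, h.2.1⟩) fun h => ⟨h.2.2, h.2.1⟩
  have hr0 : 0 ≤ r' := by
    rw [hr']
    rcases hst' with h | h
    · exact le_min (div_nonneg (by linarith) (by linarith)) (div_nonneg (by linarith) (by linarith))
    · exact le_min (div_nonneg_of_nonpos (by linarith) (by linarith))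
        (div_nonneg_of_nonpos (by linarith) (by linarith))
  have h := HadamardOp.hadamard_sum_rpow_refined_le e hA hst' hr0 (hr'.trans_le (min_le_left _ _))
    fun _ => rfl
  -- The intermediate exponent `p = (3 - 2s)/4` is the midpoint of `1 - s` and `1/2`.
  rwa [show (1 - 1 / 2 : ℝ) = 1 / 2 by norm_num,
    show 1 - (3 - 2 * s) / 4 = (1 + 2 * s) / 4 by ring] at h
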